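/- **Model.** Let $x=(x_1,\dots,x_n)\in\{0,1\}^n$ be unknown and let $\mathcal G=(\{1,\dots,n\},\mathcal E)$ be a measurement graph. On each edge $(i,j)\in\mathcal E$, $i<j$, one observes $L_{i,j}$ reads $y_{ij}^{(1)},\dots,y_{ij}^{(L_{i,j})}$, where $y_{ij}^{(k)}=x_i\oplus x_j$ with probability $1-\theta$ and $y_{ij}^{(k)}=x_i\oplus x_j\oplus 1$ with probability $\theta$, $0<\theta<1/2$; given $\mathcal G$, all reads are independent. A recovery procedure $\psi$ maps the observed graph and reads to $\{0,1\}^n$, and its probability of error is $$P_{\mathsf e}(\psi)=\max_{x\in\{0,1\}^n}\mathbb P\{\psi(y)\notin\{x,\;x\oplus\mathbf 1\}\mid x\},$$ the probability being over the reads and, if it is random, over $\mathcal G$. All parameters except $w$ may depend on $n$. Assume $\theta\ge\theta_0$ for all $n$, for a constant $\theta_0>0$. **(1) Generalized ring graph.** Let $w\ge 1$ be a fixed integer, let $(i,j)\in\mathcal E$ iff $1\le|i-j|\le w$, and let $L_{i,j}=L\,p_{|i-j|}$ (a nonnegative integer), where $L>0$ and $0<p_{\min}\le p_l\le p_{\max}$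 for $1\le l\le w$, with $p_{\min},p_{\max}$ constants. There exist constants $c_1>c_2>0$, where $c_1$ depends only on $p_{\min}$ and $c_2$ only on $p_{\min},p_{\max},\theta_0,w$, such that - $\inf_\psi P_{\mathsf e}(\psi)\to 0$ as $n\to\infty$ if $(1-2\theta)^2>c_1\frac{\log n}{L}$ for all sufficiently large $n$; - $\inf_\psi P_{\mathsf e}(\psi)\not\to 0$ as $n\to\infty$ if $(1-2\theta)^2<c_2\frac{\log n}{L}$ for infinitely many $n$. **(2) Erdős–Rényi graph.** There exist absolute constants $c_3,c_4>0$ and, for every $\theta_0>0$, a constant $c_5>0$ depending only on $\theta_0$, such that the following holds. Let $\mathcal G\sim\mathcal G_{n,p_{\mathrm{obs}}}$ (each pair of vertices is joined independently with probability $p_{\mathrm{obs}}$), let $L_{i,j}=L\ge 1$ be the same integer for all edges, and suppose $p_{\mathrm{obs}}>\frac{c_3\log n}{n}$ for all sufficiently large $n$. Then - $\inf_\psi P_{\mathsf e}(\psi)\to 0$ as $n\to\infty$ if $(1-2\theta)^2>\frac{c_4\log n}{L\,n\,p_{\mathrm{obs}}}$ for all sufficiently large $n$; - $\inf_\psi P_{\mathsf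 e}(\psi)\not\to 0$ as $n\to\infty$ if $(1-2\theta)^2<\frac{c_5\log n}{L\,n\,p_{\mathrm{obs}}}$ for infinitely many $n$. -/

import Mathlib

open MeasureTheory Filter Topology unitInterval

namespace Haplotype

/-- Index set of the available reads: the `k`-th read on the edge `(i, j)` of the measurement
graph (every edge listed once, with `i < j`), where `N i j` reads are taken on that edge. -/
abbrev ReadIndex {n : ℕ} (N : Fin n → Fin n → ℕ) (G : SimpleGraph (Fin n)) : Type :=
  Σ e : {e : Fin n × Fin n // e.1 < e.2 ∧ G.Adj e.1 e.2}, Fin (N e.1.1 e.1.2)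

open Classical in
/-- There are finitely many reads. -/
noncomputable instance {n : ℕ} (N : Fin n → Fin n → ℕ) (G : SimpleGraph (Fin n)) :
    Fintype (ReadIndex N G) := inferInstance

/-- Law of a single noisy read of the bit `b` with read error rate `θ`:
the output is `b` with probability `1 - θ` and its negation with probability `θ`. -/
noncomputable def noisyBit (θ : ℝ) (b : Bool) : Measure Bool :=
  (1 - θ).toNNReal • Measure.dirac b + θ.toNNReal • Measure.dirac (!b)

/-- Law of all the reads given the measurement graph `G` and the input `x ∈ {0,1}ⁿ`: independent
noisy reads of the parities `x i ⊕ x j`. -/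
noncomputable def readLaw {n : ℕ} (N : Fin n → Fin n → ℕ) (θ : ℝ) (x : Fin n → Bool)
    (G : SimpleGraph (Fin n)) : Measure (ReadIndex N G → Bool) :=
  Measure.pi fun r => noisyBit θ (xor (x r.1.1.1) (x r.1.1.2))

open Classical in
/-- Zero-one distance modulo a global offset (a global flip of all bits). -/
noncomputable def offsetDist {n : ℕ} (v x : Fin n → Bool) : ℕ :=
  if ∃ l : Bool, v = fun i => xor (x i) l then 0 else 1

/-- A recovery procedure: it observes the measurement graph and all the reads. -/
abbrev Recovery {n : ℕ} (N : Fin n → Fin n → ℕ) : Type :=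
  (G : SimpleGraph (Fin n)) → (ReadIndex N G → Bool) → Fin n → Bool

/-- Probability of error of the procedure `ψ` when the measurement graph has law `μ`: the maximum
over the inputs `x` of the probability, over the graph and the reads, that `ψ` does not return
`x` up to a global offset. -/
noncomputable def errorProb {n : ℕ} (μ : Measure (SimpleGraph (Fin n))) (N : Fin n → Fin n → ℕ)
    (θ : ℝ) (ψ : Recovery N) : ℝ :=
  ⨆ x : Fin n → Bool, ∫ G, (readLaw N θ x G).real {y | offsetDist (ψ G y) x ≠ 0} ∂μ

/-- The minimax probability of error. -/
noncomputable def minimaxError {n : ℕ} (μ : Measure (SimpleGraph (Fin n)))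
    (N : Fin n → Fin n → ℕ) (θ : ℝ) : ℝ :=
  ⨅ ψ : Recovery N, errorProb μ N θ ψ

/-- The generalized ring graph: distinct `i`, `j` are adjacent iff `|i - j| ≤ w`. -/
def ringGraph (n w : ℕ) : SimpleGraph (Fin n) where
  Adj i j := i ≠ j ∧ |(i : ℤ) - (j : ℤ)| ≤ w
  symm := ⟨fun _ _ h => ⟨h.1.symm, by rw [abs_sub_comm]; exact h.2⟩⟩
  loopless := ⟨fun _ h => h.1 rfl⟩

/-- Minimax probability of error on the generalized ring graph, when `m l` reads are taken between
any two adjacent vertices at separation `l = |i - j|`. -/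
noncomputable def ringMinimaxError (n w : ℕ) (m : ℕ → ℕ) (θ : ℝ) : ℝ :=
  minimaxError (Measure.dirac (ringGraph n w))
    (fun i j => m ((i : ℤ) - (j : ℤ)).natAbs) θ

/-- Minimax probability of error on the Erdős–Rényi graph with edge probability `q`, when `L` reads
are taken on every edge. -/
noncomputable def erMinimaxError (n : ℕ) (q : I) (L : ℕ) (θ : ℝ) : ℝ :=
  minimaxError (SimpleGraph.binomialRandom (Fin n) q) (fun _ _ => L) θ

end Haplotype

/-! Two inputs `x` and `x ⊕ s` are distinguished only by the reads on edges whose endpoints `s`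
separates, so every pairwise comparison depends on `s` through one number, `cutReads`. Both
directions compute a product over reads of a per-read constant raised to that power.

Achievability: the maximum likelihood decoder errs only if some `x ⊕ s`, `s` nonconstant, is at
least as likely as `x`. A union bound with Bhattacharyya coefficients gives the sum over `s` of `ρ ^
cutReads`, where `ρ = 2√(θ(1-θ)) ≤ exp(-(1-2θ)²/2)`. On the ring, keeping only edges between
consecutive vertices makes this an exactly summable product over positions where `s` changes. For
the random graph, averaging over independent edges replaces the power by `(1-p+pρ^L)^(k(n-k))` for a
cut of size `k`. In both regimes the total is at most `2((1+n⁻²)^n - 1)`, which tends to 0.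

Converse: restrict to the `n` inputs with a single one. Decoding events for distinct such inputs are
disjoint, so under the zero input their probabilities sum to at most 1. A change of measure
transfers this to the true laws, at the cost of the second moment `κ ^ cutReads` of the likelihood
ratio, where `κ = 1 + (1-2θ)²/(θ(1-θ))`. If this moment is at most `n^(1/4)`, the error is at least
`1/2`; below the threshold an isolated vertex cut carries too few reads to exceed that. -/

namespace Haplotype

/-! ### The reads of a cut -/

open Classical in
/-- The edges `(i, j)`, `i < j`, of `G` whose endpoints are separated by `s`. -/
noncomputable def cutEdges {n : ℕ} (G : SimpleGraph (Fin n)) (s : Fin n → Bool) :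
    Finset (Fin n × Fin n) :=
  {e | e.1 < e.2 ∧ G.Adj e.1 e.2 ∧ s e.1 ≠ s e.2}

/-- The number of reads on the edges of `G` separated by `s`. -/
noncomputable def cutReads {n : ℕ} (N : Fin n → Fin n → ℕ) (G : SimpleGraph (Fin n))
    (s : Fin n → Bool) : ℕ :=
  ∑ e ∈ cutEdges G s, N e.1 e.2

variable {n : ℕ} {N : Fin n → Fin n → ℕ} {G : SimpleGraph (Fin n)} {θ : ℝ}

lemma mem_cutEdges {s : Fin n → Bool} {e : Fin n × Fin n} :
    e ∈ cutEdges G s ↔ e.1 < e.2 ∧ G.Adj e.1 e.2 ∧ s e.1 ≠ s e.2 := by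
  simp [cutEdges]

lemma prod_reads_eq_pow_cutReads (N : Fin n → Fin n → ℕ) (G : SimpleGraph (Fin n))
    (s : Fin n → Bool) (a : ℝ) :
    ∏ r : ReadIndex N G, (if s r.1.1.1 = s r.1.1.2 then 1 else a) = a ^ cutReads N G s := by
  classical
  have h1 : ∏ r : ReadIndex N G, (if s r.1.1.1 = s r.1.1.2 then 1 else a) =
      ∏ e : {e : Fin n × Fin n // e.1 < e.2 ∧ G.Adj e.1 e.2},
        (if s e.1.1 = s e.1.2 then 1 else a ^ N e.1.1 e.1.2) := by
    have := Fintype.prod_sigma (fun r : ReadIndex N G => if s r.1.1.1 = s r.1.1.2 then (1 : ℝ) else a)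
    convert this using 2 with e
    split_ifs <;> simp
  rw [h1, cutReads, ← Finset.prod_pow_eq_pow_sum]
  have h2 : ∏ e ∈ Finset.univ.filter (fun e : Fin n × Fin n => e.1 < e.2 ∧ G.Adj e.1 e.2),
        (if s e.1 = s e.2 then 1 else a ^ N e.1 e.2) =
      ∏ e : {e : Fin n × Fin n // e.1 < e.2 ∧ G.Adj e.1 e.2},
        (if s e.1.1 = s e.1.2 then 1 else a ^ N e.1.1 e.1.2) :=
    Finset.prod_subtype _ (by simp) (fun e : Fin n × Fin n => if s e.1 = s e.2 then 1 else a ^ N e.1 e.2)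
  rw [← h2]
  have h3 : cutEdges G s = (Finset.univ.filter
      (fun e : Fin n × Fin n => e.1 < e.2 ∧ G.Adj e.1 e.2)).filter (fun e => ¬ s e.1 = s e.2) := by
    ext e; simp [mem_cutEdges, and_assoc]
  rw [h3]
  conv_rhs => rw [Finset.prod_filter]
  exact Finset.prod_congr rfl fun e _ => by split_ifs <;> simp_all

/-! ### The likelihood function -/

/-- The probability of the reads `y` under the input `x`. -/
noncomputable def likelihood (N : Fin n → Fin n → ℕ) (θ : ℝ) (x : Fin n → Bool)
    (G : SimpleGraph (Fin n)) (y : ReadIndex N G → Bool) : ℝ :=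
  ∏ r, if y r = xor (x r.1.1.1) (x r.1.1.2) then 1 - θ else θ

lemma likelihood_pos (h0 : 0 < θ) (h1 : θ < 1) (x : Fin n → Bool) (y : ReadIndex N G → Bool) :
    0 < likelihood N θ x G y :=
  Finset.prod_pos fun r _ => by split_ifs <;> linarith

instance (θ : ℝ) (b : Bool) : IsFiniteMeasure (noisyBit θ b) := by
  unfold noisyBit; infer_instance

lemma noisyBit_real_singleton (h0 : 0 < θ) (h1 : θ < 1) (b c : Bool) :
    (noisyBit θ b).real {c} = if c = b then 1 - θ else θ := by
  have h2 : 0 ≤ 1 - θ := by linarith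
  cases b <;> cases c <;>
    simp [noisyBit, h0.le, h2, measureReal_def]

open Classical in
lemma readLaw_real (h0 : 0 < θ) (h1 : θ < 1) (x : Fin n → Bool) (G : SimpleGraph (Fin n))
    (A : Set (ReadIndex N G → Bool)) :
    (readLaw N θ x G).real A = ∑ y with y ∈ A, likelihood N θ x G y := by
  have hA : A = ((Finset.univ.filter (· ∈ A) : Finset (ReadIndex N G → Bool)) : Set _) := by
    ext; simp
  have : IsFiniteMeasure (readLaw N θ x G) := by unfold readLaw; infer_instance
  conv_lhs => rw [hA]
  rw [← sum_measureReal_singleton]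
  refine Finset.sum_congr rfl fun y _ => ?_
  rw [readLaw, likelihood, measureReal_def, Measure.pi_singleton, ENNReal.toReal_prod]
  exact Finset.prod_congr rfl fun r _ => noisyBit_real_singleton h0 h1 _ _

lemma sum_prod_bool {ι : Type*} [Fintype ι] [DecidableEq ι] (f : ι → Bool → ℝ) :
    ∑ y : ι → Bool, ∏ r, f r (y r) = ∏ r, (f r true + f r false) := by
  rw [← Fintype.prod_sum]; simp

open Classical in
lemma sum_likelihood (x : Fin n → Bool) (G : SimpleGraph (Fin n)) :
    ∑ y, likelihood N θ x G y = 1 := by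
  unfold likelihood
  rw [sum_prod_bool (fun (r : ReadIndex N G) b =>
    if b = xor (x r.1.1.1) (x r.1.1.2) then 1 - θ else θ)]
  refine Finset.prod_eq_one fun r _ => ?_
  cases xor (x r.1.1.1) (x r.1.1.2) <;> simp

/-- The Bhattacharyya coefficient of two inputs. -/
lemma sum_sqrt_likelihood (h0 : 0 < θ) (h1 : θ < 1) (x s : Fin n → Bool) [Fintype (ReadIndex N G → Bool)] :
    ∑ y, √(likelihood N θ x G y * likelihood N θ (fun i => xor (x i) (s i)) G y) =
      (2 * √(θ * (1 - θ))) ^ cutReads N G s := by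
  classical
  have h2 : 0 < 1 - θ := by linarith
  rw [← prod_reads_eq_pow_cutReads]
  have := sum_prod_bool (fun (r : ReadIndex N G) b =>
    √((if b = xor (x r.1.1.1) (x r.1.1.2) then 1 - θ else θ) *
      (if b = xor (xor (x r.1.1.1) (s r.1.1.1)) (xor (x r.1.1.2) (s r.1.1.2)) then 1 - θ else θ)))
  refine Eq.trans ?_ (this.trans ?_)
  · refine Finset.sum_congr (by ext; simp) fun y _ => ?_
    rw [likelihood, likelihood, ← Finset.prod_mul_distrib, Real.sqrt_prod]
    intro r _
    split_ifs <;> positivity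
  -- The two parities of a read differ exactly when `s` separates its endpoints; otherwise the read
  -- contributes the total mass 1.
  · refine Finset.prod_congr rfl fun r _ => ?_
    cases x r.1.1.1 <;> cases x r.1.1.2 <;> cases s r.1.1.1 <;> cases s r.1.1.2 <;>
      simp [Real.sqrt_mul_self, h0.le, h2.le, mul_comm (1 - θ) θ, two_mul]

/-- The second moment of the likelihood ratio of two inputs. -/
lemma sum_sq_div_likelihood (h0 : 0 < θ) (h1 : θ < 1) (x s : Fin n → Bool) [Fintype (ReadIndex N G → Bool)] :
    ∑ y, likelihood N θ (fun i => xor (x i) (s i)) G y ^ 2 / likelihood N θ x G y =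
      ((1 - θ) ^ 2 / θ + θ ^ 2 / (1 - θ)) ^ cutReads N G s := by
  classical
  have h2 : 1 - θ ≠ 0 := by linarith
  have h3 := h0.ne'
  rw [← prod_reads_eq_pow_cutReads]
  have := sum_prod_bool (fun (r : ReadIndex N G) b =>
      (if b = xor (xor (x r.1.1.1) (s r.1.1.1)) (xor (x r.1.1.2) (s r.1.1.2)) then 1 - θ else θ) ^ 2
      / (if b = xor (x r.1.1.1) (x r.1.1.2) then 1 - θ else θ))
  refine Eq.trans ?_ (this.trans ?_)
  · refine Finset.sum_congr (by ext; simp) fun y _ => ?_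
    rw [likelihood, likelihood, ← Finset.prod_pow, ← Finset.prod_div_distrib]
  · refine Finset.prod_congr rfl fun r _ => ?_
    cases x r.1.1.1 <;> cases x r.1.1.2 <;> cases s r.1.1.1 <;> cases s r.1.1.2 <;>
      simp <;> field_simp <;> ring

/-! ### Achievability: the maximum likelihood decoder -/

lemma offsetDist_ne_zero {v x : Fin n → Bool} :
    offsetDist v x ≠ 0 ↔ ¬ ∃ l : Bool, v = fun i => xor (x i) l := by
  unfold offsetDist; split_ifs <;> simp_all

open Classical in
/-- The inputs that are not constant. -/
noncomputable def nonconst (n : ℕ) : Finset (Fin n → Bool) := {s | ¬ ∃ l : Bool, s = fun _ => l}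

lemma mem_nonconst {s : Fin n → Bool} : s ∈ nonconst n ↔ ¬ ∃ l : Bool, s = fun _ => l := by
  simp [nonconst]

/-- The maximum likelihood decoder. -/
noncomputable def maxLikelihood (N : Fin n → Fin n → ℕ) (θ : ℝ) : Recovery N := fun G y =>
  (Finite.exists_max fun x => likelihood N θ x G y).choose

lemma likelihood_le_maxLikelihood (y : ReadIndex N G → Bool) (x : Fin n → Bool) :
    likelihood N θ x G y ≤ likelihood N θ (maxLikelihood N θ G y) G y :=
  (Finite.exists_max fun x => likelihood N θ x G y).choose_spec x

/-- If the decoder outputs `z = x ⊕ s` wrongly, then `s` is nonconstant and `P_x(y) ≤ P_z(y)`, hence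
`P_x(y) ≤ √(P_x(y) P_z(y))`, a single term of the union bound. -/
lemma maxLikelihood_error_le (h0 : 0 < θ) (h1 : θ < 1) (x : Fin n → Bool)
    (G : SimpleGraph (Fin n)) :
    (readLaw N θ x G).real {y | offsetDist (maxLikelihood N θ G y) x ≠ 0} ≤
      ∑ s ∈ nonconst n, (2 * √(θ * (1 - θ))) ^ cutReads N G s := by
  classical
  rw [readLaw_real h0 h1]
  simp_rw [← sum_sqrt_likelihood h0 h1 x]
  rw [Finset.sum_comm, Finset.sum_filter]
  refine Finset.sum_le_sum fun y _ => ?_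
  split_ifs with hy
  · rw [Set.mem_ofPred_eq, offsetDist_ne_zero] at hy
    set z := maxLikelihood N θ G y
    set s : Fin n → Bool := fun i => xor (x i) (z i)
    have hz : z = fun i => xor (x i) (s i) := by ext i; simp [s]
    have hs : s ∈ nonconst n := by
      rw [mem_nonconst]
      rintro ⟨l, hl⟩
      exact hy ⟨l, by rw [hz, hl]⟩
    refine le_trans ?_ (Finset.single_le_sum (fun s _ => Real.sqrt_nonneg _) hs)
    rw [← hz]
    have hx := (likelihood_pos (N := N) h0 h1 x y).le
    exact Real.le_sqrt_of_sq_le (by nlinarith [likelihood_le_maxLikelihood (θ := θ) y x])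
  · exact Finset.sum_nonneg fun s _ => Real.sqrt_nonneg _

/-- With finitely many graphs, measurable singletons make every real function of the graph
integrable. -/
instance : MeasurableSingletonClass (SimpleGraph (Fin n)) :=
  ⟨fun G => by
    have : {G} = SimpleGraph.edgeSet ⁻¹' {G.edgeSet} := by
      ext H; simp
    rw [this]
    exact SimpleGraph.measurableEmbedding_edgeSet.measurable (measurableSet_singleton _)⟩

lemma integrable_graph (μ : Measure (SimpleGraph (Fin n))) [IsFiniteMeasure μ]
    (f : SimpleGraph (Fin n) → ℝ) : Integrable f μ := by
  classical
  exact Integrable.of_finite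

lemma errorProb_nonneg (μ : Measure (SimpleGraph (Fin n))) (ψ : Recovery N) :
    0 ≤ errorProb μ N θ ψ :=
  Real.iSup_nonneg fun _ => integral_nonneg fun _ => measureReal_nonneg

lemma bddBelow_errorProb (μ : Measure (SimpleGraph (Fin n))) :
    BddBelow (Set.range fun ψ : Recovery N => errorProb μ N θ ψ) :=
  ⟨0, by rintro _ ⟨ψ, rfl⟩; exact errorProb_nonneg μ ψ⟩

lemma minimaxError_nonneg (μ : Measure (SimpleGraph (Fin n))) : 0 ≤ minimaxError μ N θ :=
  Real.iInf_nonneg fun ψ => errorProb_nonneg μ ψ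

theorem minimaxError_le (μ : Measure (SimpleGraph (Fin n))) [IsProbabilityMeasure μ]
    (h0 : 0 < θ) (h1 : θ < 1) :
    minimaxError μ N θ ≤
      ∑ s ∈ nonconst n, ∫ G, (2 * √(θ * (1 - θ))) ^ cutReads N G s ∂μ := by
  refine (ciInf_le (bddBelow_errorProb μ) (maxLikelihood N θ)).trans ?_
  refine ciSup_le fun x => ?_
  rw [← integral_finsetSum _ fun s _ => integrable_graph μ _]
  exact integral_mono (integrable_graph μ _) (integrable_graph μ _) fun G =>
    maxLikelihood_error_le h0 h1 x G

/-! ### Converse: change of measure -/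

/-- The input with a single one, at the vertex `v`. -/
def single (v : Fin n) : Fin n → Bool := fun i => decide (i = v)

/-- A third vertex forces the two offsets to agree. For `n = 2` the claim fails: the two inputs are
complements of each other. -/
lemma eq_of_offset_single (hn : 3 ≤ n) {u v : Fin n} {z : Fin n → Bool}
    (hu : ∃ l : Bool, z = fun i => xor (single u i) l)
    (hv : ∃ l : Bool, z = fun i => xor (single v i) l) : u = v := by
  by_contra huv
  obtain ⟨k, hk⟩ : ∃ k : Fin n, k ∉ ({u, v} : Finset (Fin n)) := by
    by_contra! h
    have := Finset.card_le_card (fun i _ => h i : (Finset.univ : Finset (Fin n)) ⊆ {u, v})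
    have h2 := Finset.card_le_two (a := u) (b := v)
    simp at this
    omega
  obtain ⟨a, rfl⟩ := hu
  obtain ⟨b, hb⟩ := hv
  have e1 := congrFun hb k
  have e2 := congrFun hb u
  simp only [Finset.mem_insert, Finset.mem_singleton, not_or] at hk
  simp [single, hk.1, hk.2] at e1
  simp [single, huv, e1] at e2

/-- With `W` the law under the zero input, `p ≤ t p²/W + W/t` pointwise. Summed over the success
events, the first terms give second moments, and the second give at most `1/t` because the events
are disjoint. -/
lemma sum_success_le (hn : 3 ≤ n) (h0 : 0 < θ) (h1 : θ < 1) (G : SimpleGraph (Fin n))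
    (φ : (ReadIndex N G → Bool) → Fin n → Bool) {t : ℝ} (ht : 0 < t) :
    ∑ v : Fin n, (1 - (readLaw N θ (single v) G).real {y | offsetDist (φ y) (single v) ≠ 0}) ≤
      t * ∑ v : Fin n, ((1 - θ) ^ 2 / θ + θ ^ 2 / (1 - θ)) ^ cutReads N G (single v) + 1 / t := by
  classical
  set W := fun y => likelihood N θ (fun _ => false) G y
  have hW : ∀ y, 0 < W y := fun y => likelihood_pos h0 h1 _ y
  have key : ∀ v : Fin n,
      1 - (readLaw N θ (single v) G).real {y | offsetDist (φ y) (single v) ≠ 0} ≤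
      t * ((1 - θ) ^ 2 / θ + θ ^ 2 / (1 - θ)) ^ cutReads N G (single v) +
        (1 / t) * ∑ y, if offsetDist (φ y) (single v) = 0 then W y else 0 := by
    intro v
    have hsum := sum_likelihood (N := N) (θ := θ) (single v) G
    rw [readLaw_real h0 h1]
    conv_lhs => rw [← hsum]
    rw [Finset.sum_filter, ← Finset.sum_sub_distrib, ← sum_sq_div_likelihood h0 h1 (fun _ => false) (single v),
      Finset.mul_sum, Finset.mul_sum, ← Finset.sum_add_distrib]
    refine Finset.sum_le_sum fun y _ => ?_
    have hs : (fun i => xor false (single v i)) = single v := by ext; simp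
    have hp := likelihood_pos (N := N) h0 h1 (single v) y
    simp only [hs, Set.mem_ofPred_eq]
    change _ ≤ t * (likelihood N θ (single v) G y ^ 2 / W y) + _
    have hWy := hW y
    set p := likelihood N θ (single v) G y
    by_cases h : offsetDist (φ y) (single v) = 0
    · simp only [h, ne_eq, not_true_eq_false, if_false, if_true, sub_zero]
      -- Completing the square; AM-GM would even allow `2p` on the left of the inequality.
      have e : t * (p ^ 2 / W y) + 1 / t * W y - p =
          (t * W y) * ((p / W y - 1 / t) ^ 2 + p / (t * W y)) := by
        field_simp; ring
      have : 0 ≤ (t * W y) * ((p / W y - 1 / t) ^ 2 + p / (t * W y)) := by positivity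
      linarith
    · simp only [h, ne_eq, not_false_eq_true, if_true, if_false, sub_self, mul_zero, add_zero]
      positivity
  refine (Finset.sum_le_sum fun v _ => key v).trans ?_
  rw [Finset.sum_add_distrib, ← Finset.mul_sum, ← Finset.mul_sum, Finset.sum_comm]
  refine add_le_add le_rfl ?_
  have : ∑ y, ∑ v : Fin n, (if offsetDist (φ y) (single v) = 0 then W y else 0) ≤ 1 := by
    rw [← sum_likelihood (N := N) (θ := θ) (fun _ => false) G]
    refine Finset.sum_le_sum fun y _ => ?_
    rw [← Finset.sum_filter, Finset.sum_const]
    have hc : (Finset.univ.filter fun v : Fin n => offsetDist (φ y) (single v) = 0).card ≤ 1 := by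
      rw [Finset.card_le_one]
      intro u hu v hv
      simp only [Finset.mem_filter, Finset.mem_univ, true_and] at hu hv
      refine eq_of_offset_single hn (z := φ y) ?_ ?_
      · by_contra h; exact offsetDist_ne_zero.2 h hu
      · by_contra h; exact offsetDist_ne_zero.2 h hv
    rw [nsmul_eq_mul]
    have hc' : ((Finset.univ.filter fun v : Fin n =>
      offsetDist (φ y) (single v) = 0).card : ℝ) ≤ 1 := by exact_mod_cast hc
    exact mul_le_of_le_one_left (hW y).le hc'
  calc 1 / t * _ ≤ 1 / t * 1 := by gcongr
    _ = 1 / t := mul_one _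

/-- The worst-case error dominates the average error over the `n` single-one inputs. -/
theorem le_minimaxError (hn : 3 ≤ n) (μ : Measure (SimpleGraph (Fin n))) [IsProbabilityMeasure μ]
    (h0 : 0 < θ) (h1 : θ < 1) {M t : ℝ} (ht : 0 < t)
    (hM : ∀ v, ∫ G, ((1 - θ) ^ 2 / θ + θ ^ 2 / (1 - θ)) ^ cutReads N G (single v) ∂μ ≤ M) :
    1 - t * M - 1 / (t * n) ≤ minimaxError μ N θ := by
  refine le_ciInf fun ψ => ?_
  have hn0 : (0 : ℝ) < n := by positivity
  have hx : ∀ v, ∫ G, (readLaw N θ (single v) G).real {y | offsetDist (ψ G y) (single v) ≠ 0} ∂μ ≤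
      errorProb μ N θ ψ := fun v =>
    le_ciSup (f := fun x => ∫ G, (readLaw N θ x G).real {y | offsetDist (ψ G y) x ≠ 0} ∂μ)
      (Set.finite_range _).bddAbove (single v)
  have h := integral_mono (μ := μ) (integrable_graph μ _) (integrable_graph μ _)
    fun G => sum_success_le (N := N) hn h0 h1 G (ψ G) ht
  rw [integral_finsetSum _ fun s _ => integrable_graph μ _,
    integral_add (integrable_graph μ _) (integrable_graph μ _), integral_const_mul,
    integral_finsetSum _ fun s _ => integrable_graph μ _] at h
  have h2 : ∀ v : Fin n, 1 - errorProb μ N θ ψ ≤ ∫ G, (1 - (readLaw N θ (single v) G).real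
      {y | offsetDist (ψ G y) (single v) ≠ 0}) ∂μ := fun v => by
    rw [integral_sub (integrable_graph μ _) (integrable_graph μ _)]
    have := hx v
    simp only [integral_const, probReal_univ, smul_eq_mul, mul_one]
    linarith
  have h3 := Finset.sum_le_sum fun v (_ : v ∈ Finset.univ) => h2 v
  have h4 := Finset.sum_le_sum fun v (_ : v ∈ Finset.univ) => hM v
  simp only [Finset.sum_const, Finset.card_univ, Fintype.card_fin, nsmul_eq_mul, integral_const,
    probReal_univ, smul_eq_mul, one_mul] at h h3 h4
  have h5 : n * (1 - errorProb μ N θ ψ) ≤ t * (n * M) + 1 / t :=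
    h3.trans (h.trans (by gcongr))
  have h6 : n * (1 - errorProb μ N θ ψ) ≤ n * (t * M + 1 / (t * n)) := by
    refine h5.trans_eq ?_
    field_simp
  linarith [le_of_mul_le_mul_left h6 hn0]

/-- A converse in the form used below: a second moment of order `n ^ (1 / 4)` forces errors. -/
theorem half_le_minimaxError (hlog : 8 ≤ Real.log n) (μ : Measure (SimpleGraph (Fin n)))
    [IsProbabilityMeasure μ] (h0 : 0 < θ) (h1 : θ < 1)
    (hM : ∀ v, ∫ G, ((1 - θ) ^ 2 / θ + θ ^ 2 / (1 - θ)) ^ cutReads N G (single v) ∂μ ≤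
      Real.exp (Real.log n / 4)) :
    1 / 2 ≤ minimaxError μ N θ := by
  have hn0 : (0 : ℝ) < n := by
    rcases Nat.eq_zero_or_pos n with h | h
    · subst h; simp at hlog; linarith
    · exact_mod_cast h
  have hn : 3 ≤ n := by
    have : (9 : ℝ) ≤ n := by
      have := Real.add_one_le_exp (Real.log n)
      rw [Real.exp_log hn0] at this
      linarith
    have : 9 ≤ n := by exact_mod_cast this
    omega
  -- The choice `t = n^(-1/2)` leaves losses `n^(-1/4)` and `n^(-1/2)`, each at most `e⁻² ≤ 1/4`
  -- since `log n ≥ 8`.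
  refine le_trans ?_ (le_minimaxError hn μ h0 h1 (Real.exp_pos (-(Real.log n / 2))) hM)
  have e1 : Real.exp (-(Real.log n / 2)) * Real.exp (Real.log n / 4) ≤ Real.exp (-2) := by
    rw [← Real.exp_add]; exact Real.exp_le_exp.2 (by linarith)
  have e2 : 1 / (Real.exp (-(Real.log n / 2)) * n) ≤ Real.exp (-2) := by
    nth_rewrite 2 [← Real.exp_log hn0]
    rw [← Real.exp_add, one_div, ← Real.exp_neg]
    exact Real.exp_le_exp.2 (by linarith)
  have e3 : Real.exp (-2) ≤ 1 / 4 := by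
    rw [Real.exp_neg, inv_le_comm₀ (Real.exp_pos _) (by norm_num)]
    have : (2 : ℝ) ≤ Real.exp 1 := by linarith [Real.add_one_le_exp (1 : ℝ)]
    have h4 : Real.exp 2 = Real.exp 1 * Real.exp 1 := by rw [← Real.exp_add]; norm_num
    rw [h4]; nlinarith
  linarith

/-! ### Elementary estimates on the read coefficients -/

/-- The square of the left side is `1 - (1-2θ)²`. -/
lemma two_sqrt_le_exp {θ : ℝ} : 2 * √(θ * (1 - θ)) ≤ Real.exp (-((1 - 2 * θ) ^ 2 / 2)) := by
  have h : (2 * √(θ * (1 - θ))) = √(4 * (θ * (1 - θ))) := by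
    rw [show (4 : ℝ) = 2 ^ 2 by norm_num, Real.sqrt_mul (by norm_num : (0 : ℝ) ≤ 2 ^ 2),
      Real.sqrt_sq (by norm_num)]
  rw [h]
  refine Real.sqrt_le_iff.2 ⟨(Real.exp_pos _).le, ?_⟩
  rw [← Real.exp_nat_mul]
  have := Real.add_one_le_exp (-(1 - 2 * θ) ^ 2)
  calc 4 * (θ * (1 - θ)) = -(1 - 2 * θ) ^ 2 + 1 := by ring
    _ ≤ _ := this
    _ = _ := by congr 1; push_cast; ring

lemma two_sqrt_pow_le_exp {θ : ℝ} (m : ℕ) :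
    (2 * √(θ * (1 - θ))) ^ m ≤ Real.exp (-(m * (1 - 2 * θ) ^ 2 / 2)) := by
  refine (pow_le_pow_left₀ (by positivity) two_sqrt_le_exp m).trans_eq ?_
  rw [← Real.exp_nat_mul]; congr 1; ring

lemma one_le_second_moment {θ : ℝ} (h0 : 0 < θ) (h1 : θ < 1) :
    1 ≤ (1 - θ) ^ 2 / θ + θ ^ 2 / (1 - θ) := by
  have h2 : 0 < 1 - θ := by linarith
  have : (1 - θ) ^ 2 / θ + θ ^ 2 / (1 - θ) = 1 + (1 - 2 * θ) ^ 2 / (θ * (1 - θ)) := by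
    field_simp; ring
  rw [this]
  have : 0 ≤ (1 - 2 * θ) ^ 2 / (θ * (1 - θ)) := by positivity
  linarith

/-- The denominator in `1 + (1-2θ)²/(θ(1-θ))` is at least `θ₀/2`; this is how `θ₀` enters the
converse constants. -/
lemma second_moment_le_exp {θ θ₀ : ℝ} (hθ₀ : 0 < θ₀) (h0 : θ₀ ≤ θ) (h1 : θ < 1 / 2) :
    (1 - θ) ^ 2 / θ + θ ^ 2 / (1 - θ) ≤ Real.exp (2 * (1 - 2 * θ) ^ 2 / θ₀) := by
  have h2 : 0 < 1 - θ := by linarith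
  have h3 : 0 < θ := by linarith
  have : (1 - θ) ^ 2 / θ + θ ^ 2 / (1 - θ) = (1 - 2 * θ) ^ 2 / (θ * (1 - θ)) + 1 := by
    field_simp; ring
  rw [this]
  refine le_trans ?_ (Real.add_one_le_exp _)
  gcongr ?_ + 1
  have h4 : 2 * (1 - 2 * θ) ^ 2 / θ₀ = (1 - 2 * θ) ^ 2 / (θ₀ * (1 / 2)) := by
    field_simp
  rw [h4]
  gcongr
  linarith

lemma second_moment_pow_le_exp {θ θ₀ : ℝ} (hθ₀ : 0 < θ₀) (h0 : θ₀ ≤ θ) (h1 : θ < 1 / 2) (m : ℕ) :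
    ((1 - θ) ^ 2 / θ + θ ^ 2 / (1 - θ)) ^ m ≤ Real.exp (m * (2 * (1 - 2 * θ) ^ 2 / θ₀)) := by
  rw [Real.exp_nat_mul]
  have := one_le_second_moment (by linarith : 0 < θ) (by linarith)
  exact pow_le_pow_left₀ (by linarith) (second_moment_le_exp hθ₀ h0 h1) m

/-- Summing over subsets with weight `n⁻²` per element. -/
lemma tendsto_union_bound :
    Tendsto (fun n : ℕ => 2 * ((1 + Real.exp (-(2 * Real.log n))) ^ n - 1)) atTop (𝓝 0) := by
  have hu : Tendsto (fun n : ℕ => 2 * (Real.exp (1 / (n : ℝ)) - 1)) atTop (𝓝 0) := by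
    have h := (Real.continuous_exp.tendsto 0).comp tendsto_one_div_atTop_nhds_zero_nat
    have := (h.sub_const 1).const_mul 2
    simpa using this
  refine tendsto_of_tendsto_of_tendsto_of_le_of_le' tendsto_const_nhds hu ?_ ?_
  · refine Eventually.of_forall fun n => ?_
    have : (1 : ℝ) ≤ (1 + Real.exp (-(2 * Real.log n))) ^ n :=
      one_le_pow₀ (by linarith [Real.exp_pos (-(2 * Real.log n))])
    linarith
  · filter_upwards [eventually_gt_atTop 0] with n hn
    have hn0 : (0 : ℝ) < n := by exact_mod_cast hn
    have e : Real.exp (-(2 * Real.log n)) = 1 / (n : ℝ) ^ 2 := by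
      rw [Real.exp_neg, one_div, mul_comm, Real.exp_mul, Real.exp_log hn0]; norm_cast
    have h1 : (1 + Real.exp (-(2 * Real.log n))) ^ n ≤ Real.exp (1 / n) := by
      have h2 := Real.add_one_le_exp (1 / (n : ℝ) ^ 2)
      calc (1 + Real.exp (-(2 * Real.log n))) ^ n ≤ Real.exp (1 / (n : ℝ) ^ 2) ^ n := by
            rw [e]; exact pow_le_pow_left₀ (by positivity) (by linarith) n
        _ = Real.exp (1 / n) := by rw [← Real.exp_nat_mul]; congr 1; field_simp
    linarith

lemma eventually_eight_le_log : ∀ᶠ n : ℕ in atTop, 8 ≤ Real.log n :=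
  (Real.tendsto_log_atTop.comp tendsto_natCast_atTop_atTop).eventually_ge_atTop 8

/-! ### Ring graphs -/

/-- A binary string is determined by its first bit and the set of positions where it changes. -/
lemma sum_pow_changes (k : ℕ) (x : ℝ) :
    ∑ s : Fin (k + 1) → Bool, ∏ i : Fin k, (if s i.castSucc = s i.succ then 1 else x) =
      2 * (1 + x) ^ k := by
  induction k with
  | zero => simp
  | succ k ih =>
    rw [← (Fin.consEquiv fun _ => Bool).sum_comp, Fintype.sum_prod_type]
    rw [Finset.sum_comm, pow_succ, ← mul_assoc, ← ih, Finset.sum_mul]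
    refine Finset.sum_congr rfl fun t _ => ?_
    simp only [Fin.consEquiv_apply, Fin.prod_univ_succ (n := k), Fin.castSucc_zero, Fin.cons_zero,
      Fin.cons_succ, ← Fin.succ_castSucc, Fintype.sum_bool]
    cases t 0 <;> simp <;> ring

/-- Only edges between consecutive vertices are kept, so the achievability constant involves neither
`w` nor `pmax`. -/
lemma changes_le_cutReads {k w : ℕ} (hw : 1 ≤ w) (m : ℕ → ℕ) (s : Fin (k + 1) → Bool) :
    (Finset.univ.filter fun i : Fin k => s i.castSucc ≠ s i.succ).card * m 1 ≤
      cutReads (fun i j : Fin (k + 1) => m ((i : ℤ) - (j : ℤ)).natAbs) (ringGraph (k + 1) w) s := by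
  classical
  let f : Fin k ↪ Fin (k + 1) × Fin (k + 1) :=
    ⟨fun i => (i.castSucc, i.succ), fun i j h => by simpa using congrArg Prod.fst h⟩
  rw [cutReads]
  have hsub : (Finset.univ.filter fun i : Fin k => s i.castSucc ≠ s i.succ).map f ⊆
      cutEdges (ringGraph (k + 1) w) s := by
    intro e he
    simp only [Finset.mem_map, Finset.mem_filter, Finset.mem_univ, true_and] at he
    obtain ⟨i, hi, rfl⟩ := he
    refine mem_cutEdges.2 ⟨Fin.castSucc_lt_succ, ⟨Fin.castSucc_lt_succ.ne, ?_⟩, hi⟩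
    change |((i.castSucc : ℕ) : ℤ) - ((i.succ : ℕ) : ℤ)| ≤ w
    rw [abs_le, Fin.val_castSucc, Fin.val_succ]
    omega
  refine le_trans (le_of_eq ?_) (Finset.sum_le_sum_of_subset hsub)
  rw [Finset.sum_map, ← smul_eq_mul, ← Finset.sum_const]
  refine Finset.sum_congr rfl fun i _ => ?_
  change m 1 = m (((i.castSucc : ℕ) : ℤ) - ((i.succ : ℕ) : ℤ)).natAbs
  rw [Fin.val_castSucc, Fin.val_succ]
  congr 1
  omega

lemma ringMinimaxError_le {k w : ℕ} (hw : 1 ≤ w) (m : ℕ → ℕ) {θ : ℝ} (h0 : 0 < θ) (h1 : θ < 1) :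
    ringMinimaxError (k + 1) w m θ ≤ 2 * ((1 + (2 * √(θ * (1 - θ))) ^ m 1) ^ k - 1) := by
  classical
  refine (minimaxError_le _ h0 h1).trans ?_
  simp only [integral_dirac]
  have hρ0 : 0 ≤ 2 * √(θ * (1 - θ)) := by positivity
  have hρ1 : 2 * √(θ * (1 - θ)) ≤ 1 :=
    two_sqrt_le_exp.trans (Real.exp_le_one_iff.2 (by have := sq_nonneg (1 - 2 * θ); linarith))
  set ρ := 2 * √(θ * (1 - θ))
  set x := ρ ^ m 1
  have hx : ∀ s : Fin (k + 1) → Bool, ρ ^ cutReads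
      (fun i j : Fin (k + 1) => m ((i : ℤ) - (j : ℤ)).natAbs) (ringGraph (k + 1) w) s ≤
      ∏ i : Fin k, (if s i.castSucc = s i.succ then 1 else x) := by
    intro s
    refine (pow_le_pow_of_le_one hρ0 hρ1 (changes_le_cutReads hw m s)).trans_eq ?_
    rw [mul_comm, pow_mul, Finset.prod_ite]
    simp [x]
  refine (Finset.sum_le_sum fun s _ => hx s).trans ?_
  have hs := sum_pow_changes k x
  rw [← Finset.sum_add_sum_compl (nonconst (k + 1))] at hs
  -- The two constant strings have no change, so each contributes 1; removing them produces the `-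
  -- 1` in the bound.
  have hc : (2 : ℝ) ≤ ∑ s ∈ (nonconst (k + 1))ᶜ,
      ∏ i : Fin k, (if s i.castSucc = s i.succ then 1 else x) := by
    have hne : (fun _ : Fin (k + 1) => true) ≠ fun _ => false := fun h => by
      simpa using congrFun h 0
    have hsub : {(fun _ => true), (fun _ => false)} ⊆ (nonconst (k + 1))ᶜ := by
      intro s hs
      rw [Finset.mem_compl, mem_nonconst, not_not]
      simp only [Finset.mem_insert, Finset.mem_singleton] at hs
      rcases hs with h | h
      exacts [⟨_, h⟩, ⟨_, h⟩]
    refine le_trans (le_of_eq ?_) (Finset.sum_le_sum_of_subset_of_nonneg hsub fun s _ _ =>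
      Finset.prod_nonneg fun i _ => by split_ifs <;> positivity)
    rw [Finset.sum_pair hne]
    norm_num
  linarith

lemma cutReads_ring_single_le {n w : ℕ} (m : ℕ → ℕ) (v : Fin n) {B : ℝ} (hB : 0 ≤ B)
    (hm : ∀ l, 1 ≤ l → l ≤ w → (m l : ℝ) ≤ B) :
    (cutReads (fun i j : Fin n => m ((i : ℤ) - (j : ℤ)).natAbs) (ringGraph n w) (single v) : ℝ) ≤
      (2 * w + 1) * B := by
  classical
  rw [cutReads]
  push_cast
  have hcard : (cutEdges (ringGraph n w) (single v)).card ≤ 2 * w + 1 := by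
    have h2 : (Finset.Icc (-(w : ℤ)) w).card = 2 * w + 1 := by simp; omega
    rw [← h2]
    have hv : ∀ e ∈ cutEdges (ringGraph n w) (single v),
        |((e.1 : ℕ) : ℤ) - ((e.2 : ℕ) : ℤ)| ≤ w ∧ (e.1 : ℕ) < e.2 ∧
          (((e.1 : ℕ) = v ∧ (e.2 : ℕ) ≠ v) ∨ ((e.1 : ℕ) ≠ v ∧ (e.2 : ℕ) = v)) := by
      intro e he
      obtain ⟨hlt, ⟨_, hw⟩, hs⟩ := mem_cutEdges.1 he
      refine ⟨hw, hlt, ?_⟩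
      simp only [single, ne_eq, decide_eq_decide] at hs
      simp only [ne_eq, ← Fin.ext_iff]
      tauto
    -- This map sends an edge at `v` to the signed displacement of its other endpoint, an integer in
    -- `[-w, w]`.
    refine Finset.card_le_card_of_injOn
      (fun e => ((e.1 : ℕ) : ℤ) + ((e.2 : ℕ) : ℤ) - 2 * ((v : ℕ) : ℤ)) ?_ ?_
    · intro e he
      obtain ⟨ha, hb, hc⟩ := hv e he
      rw [abs_le] at ha
      simp only [Finset.coe_Icc, Set.mem_Icc]
      omega
    · intro e he f hf hef
      obtain ⟨ha, hb, hc⟩ := hv e he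
      obtain ⟨ha', hb', hc'⟩ := hv f hf
      simp only at hef
      refine Prod.ext (Fin.ext ?_) (Fin.ext ?_) <;> omega
  calc ∑ e ∈ cutEdges (ringGraph n w) (single v), (m (((e.1 : ℕ) : ℤ) - (e.2 : ℕ)).natAbs : ℝ)
      ≤ ∑ e ∈ cutEdges (ringGraph n w) (single v), B := by
        refine Finset.sum_le_sum fun e he => ?_
        obtain ⟨hlt, ⟨_, hw⟩, -⟩ := mem_cutEdges.1 he
        have hlt' : (e.1 : ℕ) < e.2 := hlt
        rw [abs_le] at hw
        exact hm _ (by omega) (by omega)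
    _ = (cutEdges (ringGraph n w) (single v)).card * B := by simp
    _ ≤ (2 * w + 1) * B := by
        gcongr
        exact_mod_cast hcard

theorem tendsto_ringMinimaxError {pmin : ℝ} (hp : 0 < pmin) {w : ℕ} (hw : 1 ≤ w) {θ L : ℕ → ℝ}
    {m : ℕ → ℕ → ℕ} (h0 : ∀ n, 0 < θ n) (h1 : ∀ n, θ n < 1) (hL : ∀ n, 0 < L n)
    (hm : ∀ n, L n * pmin ≤ m n 1)
    (h : ∀ᶠ n : ℕ in atTop, 4 / pmin * (Real.log n / L n) < (1 - 2 * θ n) ^ 2) :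
    Tendsto (fun n => ringMinimaxError n w (m n) (θ n)) atTop (𝓝 0) := by
  refine tendsto_of_tendsto_of_tendsto_of_le_of_le' tendsto_const_nhds tendsto_union_bound
    (Eventually.of_forall fun n => minimaxError_nonneg _) ?_
  filter_upwards [h, eventually_gt_atTop 0] with n hn hn0
  obtain ⟨k, rfl⟩ := Nat.exists_eq_succ_of_ne_zero hn0.ne'
  refine (ringMinimaxError_le hw (m _) (h0 _) (h1 _)).trans ?_
  have hx : (2 * √(θ (k + 1) * (1 - θ (k + 1)))) ^ m (k + 1) 1 ≤
      Real.exp (-(2 * Real.log ((k + 1 : ℕ) : ℝ))) := by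
    refine (two_sqrt_pow_le_exp _).trans (Real.exp_le_exp.2 ?_)
    have hL' := hL (k + 1)
    -- The constant `4 / pmin` is what makes each change cost a factor at most `n⁻²`.
    have e : 4 * Real.log ((k + 1 : ℕ) : ℝ) =
        4 / pmin * (Real.log ((k + 1 : ℕ) : ℝ) / L (k + 1)) * (L (k + 1) * pmin) := by
      field_simp
    have h3 : 4 * Real.log ((k + 1 : ℕ) : ℝ) ≤
        (1 - 2 * θ (k + 1)) ^ 2 * m (k + 1) 1 := by
      rw [e]
      exact (mul_le_mul_of_nonneg_right hn.le (by positivity)).trans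
        (mul_le_mul_of_nonneg_left (hm _) (sq_nonneg _))
    linarith
  set x := Real.exp (-(2 * Real.log ((k + 1 : ℕ) : ℝ)))
  have hx0 : 0 < x := Real.exp_pos _
  have : (1 + (2 * √(θ (k + 1) * (1 - θ (k + 1)))) ^ m (k + 1) 1) ^ k ≤ (1 + x) ^ (k + 1) :=
    (pow_le_pow_left₀ (by positivity) (by linarith) k).trans
      (pow_le_pow_right₀ (by linarith) (Nat.le_succ k))
  simp only [Nat.succ_eq_add_one]
  linarith

theorem not_tendsto_ringMinimaxError {θ₀ q : ℝ} (hθ₀ : 0 < θ₀) (hq : 0 < q) {w : ℕ}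
    {θ L : ℕ → ℝ} {m : ℕ → ℕ → ℕ} (hθ : ∀ n, θ₀ ≤ θ n ∧ θ n < 1 / 2) (hL : ∀ n, 0 < L n)
    (hm : ∀ n l, 1 ≤ l → l ≤ w → (m n l : ℝ) ≤ L n * q) {c : ℝ}
    (hc : c ≤ θ₀ / (8 * (2 * w + 1) * q))
    (h : ∃ᶠ n : ℕ in atTop, (1 - 2 * θ n) ^ 2 < c * (Real.log n / L n)) :
    ¬ Tendsto (fun n => ringMinimaxError n w (m n) (θ n)) atTop (𝓝 0) := by
  intro ht
  have hlt := ht.eventually_lt_const (show (0 : ℝ) < 1 / 2 by norm_num)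
  obtain ⟨n, hn, hlt, hlog⟩ := (h.and_eventually (hlt.and eventually_eight_le_log)).exists
  refine absurd hlt (not_lt.2 ?_)
  have h0 : 0 < θ n := hθ₀.trans_le (hθ n).1
  have h1 := (hθ n).2
  have hLn := hL n
  refine half_le_minimaxError hlog _ h0 (by linarith) fun v => ?_
  rw [integral_dirac]
  refine (second_moment_pow_le_exp hθ₀ (hθ n).1 h1 _).trans (Real.exp_le_exp.2 ?_)
  have hr := cutReads_ring_single_le (w := w) (m n) v (by positivity) (hm n)
  -- At most `(2w+1) L q` reads touch `v`; this constant makes the second-moment exponent exactly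
  -- `log n / 4`.
  have h2 : (1 - 2 * θ n) ^ 2 ≤ θ₀ / (8 * (2 * w + 1) * q) * (Real.log n / L n) :=
    hn.le.trans (by gcongr)
  calc _ ≤ (2 * w + 1) * (L n * q) *
        (2 * (θ₀ / (8 * (2 * w + 1) * q) * (Real.log n / L n)) / θ₀) := by gcongr
    _ = Real.log n / 4 := by field_simp; norm_num

/-! ### Erdős–Rényi graphs -/

/-- The pairs of vertices separated by `s`. -/
def cutPairs (s : Fin n → Bool) : Finset (Sym2 (Fin n)) :=
  (Finset.univ.filter fun e : Fin n × Fin n => s e.1 = true ∧ s e.2 = false).image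
    fun e => s(e.1, e.2)

lemma mem_cutPairs {s : Fin n → Bool} {i j : Fin n} : s(i, j) ∈ cutPairs s ↔ s i ≠ s j := by
  simp only [cutPairs, Finset.mem_image, Finset.mem_filter, Finset.mem_univ, true_and,
    Prod.exists, Sym2.eq_iff]
  constructor
  · rintro ⟨a, b, ⟨ha, hb⟩, ⟨rfl, rfl⟩ | ⟨rfl, rfl⟩⟩ <;> simp [ha, hb]
  · intro h
    cases hi : s i <;> cases hj : s j
    · simp [hi, hj] at h
    · exact ⟨j, i, ⟨hj, hi⟩, Or.inr ⟨rfl, rfl⟩⟩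
    · exact ⟨i, j, ⟨hi, hj⟩, Or.inl ⟨rfl, rfl⟩⟩
    · simp [hi, hj] at h

/-- The number of ones of `s`. -/
def weight (s : Fin n → Bool) : ℕ := (Finset.univ.filter fun i => s i = true).card

lemma weight_le (s : Fin n → Bool) : weight s ≤ n := by
  simpa [weight] using Finset.card_le_univ (Finset.univ.filter fun i => s i = true)

lemma card_filter_false (s : Fin n → Bool) :
    (Finset.univ.filter fun i => s i = false).card = n - weight s := by
  have h := Finset.card_filter_add_card_filter_not (s := (Finset.univ : Finset (Fin n)))
    (fun i => s i = true)
  simp only [Bool.not_eq_true, Finset.card_univ, Fintype.card_fin] at h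
  unfold weight; omega

lemma card_cutPairs (s : Fin n → Bool) : (cutPairs s).card = weight s * (n - weight s) := by
  rw [cutPairs, Finset.card_image_of_injOn, ← card_filter_false, weight, ← Finset.card_product]
  · congr 1; ext e; simp
  · rintro ⟨a, b⟩ hab ⟨c, d⟩ hcd h
    simp only [Finset.coe_filter, Finset.mem_univ, true_and, Set.mem_ofPred_eq] at hab hcd
    rcases Sym2.eq_iff.1 h with h | ⟨rfl, rfl⟩
    · exact Prod.ext h.1 h.2
    · simp [hab.1] at hcd

lemma weight_single (v : Fin n) : weight (single v) = 1 := by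
  simp [weight, single, Finset.filter_eq']

open Classical in
lemma card_cutEdges (G : SimpleGraph (Fin n)) (s : Fin n → Bool) :
    (cutEdges G s).card = ((cutPairs s).filter (· ∈ G.edgeSet)).card := by
  refine Finset.card_bij (fun e _ => s(e.1, e.2)) ?_ ?_ ?_
  · intro e he
    obtain ⟨-, h1, h2⟩ := mem_cutEdges.1 he
    simpa [mem_cutPairs] using ⟨h2, h1⟩
  · rintro ⟨a, b⟩ he ⟨c, d⟩ hf h
    have h1 := (mem_cutEdges.1 he).1
    have h2 := (mem_cutEdges.1 hf).1
    rcases Sym2.eq_iff.1 h with h | ⟨rfl, rfl⟩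
    · exact Prod.ext h.1 h.2
    · exact absurd h1 h2.not_gt
  · intro q hq
    induction q with | _ i j
    simp only [Finset.mem_filter, mem_cutPairs, SimpleGraph.mem_edgeSet] at hq
    rcases lt_or_gt_of_ne hq.2.ne with h | h
    · exact ⟨(i, j), mem_cutEdges.2 ⟨h, hq.2, hq.1⟩, rfl⟩
    · exact ⟨(j, i), mem_cutEdges.2 ⟨h, hq.2.symm, hq.1.symm⟩, Sym2.eq_swap⟩

lemma pow_card_cutEdges (G : SimpleGraph (Fin n)) (s : Fin n → Bool) (A : ℝ)
    [DecidablePred fun q : Sym2 (Fin n) => q ∈ cutPairs s ∧ q ∈ G.edgeSet] :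
    A ^ (cutEdges G s).card =
      ∏ q : Sym2 (Fin n), if q ∈ cutPairs s ∧ q ∈ G.edgeSet then A else 1 := by
  classical
  rw [card_cutEdges, Finset.prod_ite, Finset.prod_const, Finset.prod_const_one, mul_one]
  congr 2
  ext q; simp

/-- The generating function of the number of edges of a random graph across a cut. -/
lemma integral_pow_card_cutEdges (p : I) (s : Fin n → Bool) (A : ℝ) :
    ∫ G, A ^ (cutEdges G s).card ∂(SimpleGraph.binomialRandom (Fin n) p) =
      (1 - p + p * A) ^ (weight s * (n - weight s)) := by
  classical
  rw [SimpleGraph.binomialRandom_eq_map, integral_map (by fun_prop)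
    (integrable_graph (Measure.map _ _) _).aestronglyMeasurable,
    ProbabilityTheory.setBernoulli_eq_map, integral_map, Measure.infinitePi_eq_pi]
  · let F : Sym2 (Fin n) → Prop → ℝ := fun q b => if q ∈ cutPairs s ∧ b then A else 1
    have h : ∀ P : Sym2 (Fin n) → Prop,
        A ^ (cutEdges (SimpleGraph.fromEdgeSet {q | P q}) s).card = ∏ q, F q (P q) := by
      intro P
      rw [pow_card_cutEdges]
      refine Finset.prod_congr rfl fun q _ => ?_
      induction q with | _ i j
      by_cases hij : i = j
      · subst hij; simp [F, mem_cutPairs]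
      · simp [F, hij]
    simp_rw [h]
    rw [integral_fintype_prod_eq_prod (f := F), ← card_cutPairs, ← Finset.prod_const,
      ← Finset.prod_subset (Finset.subset_univ (cutPairs s))]
    · refine Finset.prod_congr rfl fun q hq => ?_
      -- A separated pair is off the diagonal, so it is an edge with probability `p` and its factor
      -- integrates to `1 - p + pA`.
      have hd : q ∈ (Sym2.diagSetᶜ : Set (Sym2 (Fin n))) := by
        induction q with | _ i j
        have : i ≠ j := fun h => mem_cutPairs.1 hq (by rw [h])
        simpa using this
      rw [integral_add_measure Integrable.of_finite Integrable.of_finite,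
        integral_smul_nnreal_measure, integral_smul_nnreal_measure, integral_dirac, integral_dirac]
      simp [F, hq, hd, NNReal.smul_def]
      ring
    · intro q _ hq
      rw [integral_add_measure Integrable.of_finite Integrable.of_finite,
        integral_smul_nnreal_measure, integral_smul_nnreal_measure, integral_dirac, integral_dirac]
      simp [F, hq, NNReal.smul_def]
  · exact (MeasurableEquiv.setOfPred.symm.measurable.comp measurable_id).aemeasurable
  · exact AEStronglyMeasurable.of_discrete

lemma cutReads_const (L : ℕ) (G : SimpleGraph (Fin n)) (s : Fin n → Bool) :
    cutReads (fun _ _ => L) G s = L * (cutEdges G s).card := by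
  simp [cutReads, mul_comm]

lemma integral_pow_cutReads (p : I) (L : ℕ) (s : Fin n → Bool) (a : ℝ) :
    ∫ G, a ^ cutReads (fun _ _ => L) G s ∂(SimpleGraph.binomialRandom (Fin n) p) =
      (1 - p + p * a ^ L) ^ (weight s * (n - weight s)) := by
  simp_rw [cutReads_const, pow_mul a]
  exact integral_pow_card_cutEdges p s _

lemma pow_weight (s : Fin n → Bool) (x : ℝ) :
    x ^ weight s = ∏ i, if s i = true then x else 1 := by
  rw [Finset.prod_ite]; simp [weight]

lemma pow_sub_weight (s : Fin n → Bool) (x : ℝ) :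
    x ^ (n - weight s) = ∏ i, if s i = true then 1 else x := by
  rw [Finset.prod_ite]; simp [← card_filter_false]

lemma sum_nonconst_le (f : (Fin n → Bool) → ℝ) (hf : ∀ s, 0 ≤ f s) (b : Bool)
    (hb : f (fun _ => b) = 1) : ∑ s ∈ nonconst n, f s ≤ ∑ s, f s - 1 := by
  classical
  rw [← hb, ← Finset.sum_erase_eq_sub (Finset.mem_univ _)]
  refine Finset.sum_le_sum_of_subset_of_nonneg (fun s hs => ?_) fun s _ _ => hf s
  exact Finset.mem_erase.2 ⟨fun h => mem_nonconst.1 hs ⟨b, h⟩, Finset.mem_univ _⟩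

/-- Each of the two sums over all `s` is `(1 + x)^n` by the binomial theorem; the all-zero string
accounts for a term 1 in the first and the all-one string in the second. -/
lemma sum_weights_le {x : ℝ} (hx : 0 ≤ x) :
    ∑ s ∈ nonconst n, (x ^ weight s + x ^ (n - weight s)) ≤ 2 * ((1 + x) ^ n - 1) := by
  classical
  have h1 := sum_nonconst_le (fun s : Fin n → Bool => x ^ weight s) (fun s => by positivity) false
    (by simp [weight])
  have h2 := sum_nonconst_le (fun s : Fin n → Bool => x ^ (n - weight s)) (fun s => by positivity)
    true (by simp [weight])
  simp_rw [pow_weight] at h1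
  simp_rw [pow_sub_weight] at h2
  rw [sum_prod_bool (fun (_ : Fin n) b => if b = true then x else 1)] at h1
  rw [sum_prod_bool (fun (_ : Fin n) b => if b = true then 1 else x)] at h2
  simp_rw [pow_weight, pow_sub_weight]
  simp only [if_true, Bool.false_eq_true, if_false, Finset.prod_const, Finset.card_univ,
    Fintype.card_fin] at h1 h2
  rw [Finset.sum_add_distrib]
  rw [add_comm x 1] at h1
  linarith

/-- The larger side of the cut has at least `n/2` vertices, so each vertex of the smaller side
contributes at least `nu/2 ≥ 2ℓ` to the exponent. -/
lemma cut_exponent_le {k n : ℕ} (hk : k ≤ n) {u ℓ : ℝ} (hu : 0 ≤ u) (h : 4 * ℓ ≤ n * u) :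
    Real.exp (-u) ^ (k * (n - k)) ≤
      Real.exp (-(2 * ℓ)) ^ k + Real.exp (-(2 * ℓ)) ^ (n - k) := by
  simp_rw [← Real.exp_nat_mul]
  push_cast [hk]
  have hk' : (k : ℝ) ≤ n := by exact_mod_cast hk
  have hk0 : (0 : ℝ) ≤ k := by positivity
  rcases le_total (2 * (k : ℝ)) n with h2 | h2
  · refine le_trans (Real.exp_le_exp.2 ?_) (le_add_of_nonneg_right (Real.exp_pos _).le)
    have h3 : (k : ℝ) * (4 * ℓ) ≤ k * (2 * (n - k) * u) :=
      mul_le_mul_of_nonneg_left (h.trans (mul_le_mul_of_nonneg_right (by linarith) hu)) hk0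
    linarith
  · refine le_trans (Real.exp_le_exp.2 ?_) (le_add_of_nonneg_left (Real.exp_pos _).le)
    have h3 : ((n : ℝ) - k) * (4 * ℓ) ≤ (n - k) * (2 * k * u) :=
      mul_le_mul_of_nonneg_left (h.trans (mul_le_mul_of_nonneg_right h2 hu)) (by linarith)
    linarith

lemma erMinimaxError_le (p : I) (L : ℕ) {θ : ℝ} (h0 : 0 < θ) (h1 : θ < 1)
    (h : 4 * Real.log n ≤ n * (p * (1 - (2 * √(θ * (1 - θ))) ^ L))) :
    erMinimaxError n p L θ ≤ 2 * ((1 + Real.exp (-(2 * Real.log n))) ^ n - 1) := by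
  refine (minimaxError_le _ h0 h1).trans (le_trans ?_ (sum_weights_le (Real.exp_pos _).le))
  refine Finset.sum_le_sum fun s _ => ?_
  rw [integral_pow_cutReads]
  have hρ0 : 0 ≤ (2 * √(θ * (1 - θ))) ^ L := by positivity
  have hρ1 : (2 * √(θ * (1 - θ))) ^ L ≤ 1 :=
    (two_sqrt_pow_le_exp L).trans (Real.exp_le_one_iff.2 (by
      have : 0 ≤ L * (1 - 2 * θ) ^ 2 / 2 := by positivity
      linarith))
  set r := (2 * √(θ * (1 - θ))) ^ L
  have hp0 := p.2.1
  have hp1 := p.2.2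
  refine le_trans ?_ (cut_exponent_le (weight_le s)
    (mul_nonneg hp0 (sub_nonneg.2 hρ1)) h)
  refine pow_le_pow_left₀ ?_ ?_ _
  · have := mul_nonneg hp0 hρ0; linarith
  · have := Real.add_one_le_exp (-((p : ℝ) * (1 - r)))
    linarith

lemma third_min_le_one_sub_exp {t : ℝ} (ht : 0 ≤ t) : min 1 t / 3 ≤ 1 - Real.exp (-(t / 2)) := by
  have h1 : Real.exp (-(t / 2)) ≤ 1 / (1 + t / 2) := by
    rw [Real.exp_neg, ← one_div]
    exact one_div_le_one_div_of_le (by linarith) (by linarith [Real.add_one_le_exp (t / 2)])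
  have h2 : min 1 t / 3 ≤ 1 - 1 / (1 + t / 2) := by
    have h3 : 1 - 1 / (1 + t / 2) = t / (2 + t) := by
      field_simp; ring
    rw [h3, le_div_iff₀ (by linarith)]
    rcases le_total 1 t with h | h
    · rw [min_eq_left h]; linarith
    · rw [min_eq_right h]; nlinarith
  linarith

theorem tendsto_erMinimaxError {θ : ℕ → ℝ} {L : ℕ → ℕ} {p : ℕ → I} (h0 : ∀ n, 0 < θ n)
    (h1 : ∀ n, θ n < 1) (hL : ∀ n, 1 ≤ L n)
    (hp : ∀ᶠ n : ℕ in atTop, 12 * Real.log n / n < (p n : ℝ))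
    (h : ∀ᶠ n : ℕ in atTop, 12 * Real.log n / (L n * n * (p n : ℝ)) < (1 - 2 * θ n) ^ 2) :
    Tendsto (fun n => erMinimaxError n (p n) (L n) (θ n)) atTop (𝓝 0) := by
  refine tendsto_of_tendsto_of_tendsto_of_le_of_le' tendsto_const_nhds tendsto_union_bound
    (Eventually.of_forall fun n => minimaxError_nonneg _) ?_
  filter_upwards [hp, h, eventually_gt_atTop 0, eventually_eight_le_log] with n hpn hn hn0 hlog
  refine erMinimaxError_le _ _ (h0 n) (h1 n) ?_
  have hn0' : (0 : ℝ) < n := by exact_mod_cast hn0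
  have hL0 : (0 : ℝ) < L n := by exact_mod_cast hL n
  have hp0 : 0 < (p n : ℝ) := lt_trans (by positivity) hpn
  rw [div_lt_iff₀ hn0'] at hpn
  rw [div_lt_iff₀ (by positivity)] at hn
  have h3 := third_min_le_one_sub_exp (t := L n * (1 - 2 * θ n) ^ 2) (by positivity)
  have h4 := two_sqrt_pow_le_exp (θ := θ n) (L n)
  have h5 : min 1 ((L n : ℝ) * (1 - 2 * θ n) ^ 2) / 3 ≤
      1 - (2 * √(θ n * (1 - θ n))) ^ L n := by linarith
  refine le_trans ?_ (mul_le_mul_of_nonneg_left (mul_le_mul_of_nonneg_left h5 hp0.le) hn0'.le)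
  -- If reads on one edge are already informative, the density assumption on `p` suffices; otherwise
  -- the noise assumption is used. Both constants are `12 = 3 · 4`, from the factor `1/3` and the
  -- required `4 log n`.
  rcases le_total 1 ((L n : ℝ) * (1 - 2 * θ n) ^ 2) with h6 | h6
  · rw [min_eq_left h6]; linarith
  · rw [min_eq_right h6]; linarith

theorem not_tendsto_erMinimaxError {θ₀ : ℝ} (hθ₀ : 0 < θ₀) {θ : ℕ → ℝ} {L : ℕ → ℕ} {p : ℕ → I}
    (hθ : ∀ n, θ₀ ≤ θ n ∧ θ n < 1 / 2) (hL : ∀ n, 1 ≤ L n)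
    (hp : ∀ᶠ n : ℕ in atTop, 12 * Real.log n / n < (p n : ℝ))
    (h : ∃ᶠ n : ℕ in atTop,
      (1 - 2 * θ n) ^ 2 < θ₀ / 16 * Real.log n / (L n * n * (p n : ℝ))) :
    ¬ Tendsto (fun n => erMinimaxError n (p n) (L n) (θ n)) atTop (𝓝 0) := by
  intro ht
  have hlt := ht.eventually_lt_const (show (0 : ℝ) < 1 / 2 by norm_num)
  obtain ⟨n, hn, hlt, hlog, hpn, hn0⟩ := (h.and_eventually
    (hlt.and (eventually_eight_le_log.and (hp.and (eventually_gt_atTop 0))))).exists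
  refine absurd hlt (not_lt.2 ?_)
  have h0 : 0 < θ n := hθ₀.trans_le (hθ n).1
  have h1 := (hθ n).2
  have hn0' : (0 : ℝ) < n := by exact_mod_cast hn0
  have hL0 : (0 : ℝ) < L n := by exact_mod_cast hL n
  have hp0 : 0 < (p n : ℝ) := lt_trans (by positivity) hpn
  rw [div_lt_iff₀ hn0'] at hpn
  rw [lt_div_iff₀ (by positivity)] at hn
  refine half_le_minimaxError hlog _ h0 (by linarith) fun v => ?_
  rw [integral_pow_cutReads, weight_single, one_mul]
  set u := L n * (2 * (1 - 2 * θ n) ^ 2 / θ₀) with hu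
  have hu0 : 0 ≤ u := by positivity
  have hnpu : n * (p n : ℝ) * u ≤ Real.log n / 8 := by
    have e : n * (p n : ℝ) * u = (1 - 2 * θ n) ^ 2 * (L n * n * (p n : ℝ)) * (2 / θ₀) := by
      rw [hu]; ring
    rw [e]
    calc _ ≤ θ₀ / 16 * Real.log n * (2 / θ₀) := by gcongr
      _ = Real.log n / 8 := by field_simp; norm_num
  -- Here the density assumption enters: `np > 12 log n` while `npu ≤ log n / 8`. Then `u ≤ 1`
  -- permits `exp u ≤ 1 + 2u`, linearizing the average over the random degree.
  have hu1 : u ≤ 1 := by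
    by_contra! hu1
    have := mul_lt_mul_of_pos_left hu1 (mul_pos hn0' hp0)
    linarith
  have hκ := second_moment_pow_le_exp hθ₀ (hθ n).1 h1 (L n)
  rw [← hu] at hκ
  have hκ1 : 1 ≤ ((1 - θ n) ^ 2 / θ n + θ n ^ 2 / (1 - θ n)) ^ L n :=
    one_le_pow₀ (one_le_second_moment h0 (by linarith))
  have hexp : Real.exp u ≤ 1 + 2 * u := by
    have h2 := Real.abs_exp_sub_one_sub_id_le (x := u) (by rwa [abs_of_nonneg hu0])
    have h3 := le_of_abs_le h2
    nlinarith
  set K := ((1 - θ n) ^ 2 / θ n + θ n ^ 2 / (1 - θ n)) ^ L n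
  have hpK : p n * K ≤ p n * (1 + 2 * u) := mul_le_mul_of_nonneg_left (hκ.trans hexp) hp0.le
  have hpK1 : (p n : ℝ) ≤ p n * K := le_mul_of_one_le_right hp0.le hκ1
  have hb1 : 1 ≤ 1 - (p n : ℝ) + p n * K := by linarith
  calc (1 - (p n : ℝ) + p n * K) ^ (n - 1) ≤ (1 - (p n : ℝ) + p n * K) ^ n :=
        pow_le_pow_right₀ hb1 (Nat.sub_le _ _)
    _ ≤ Real.exp (p n * (2 * u)) ^ n := by
        refine pow_le_pow_left₀ (by linarith) ?_ _
        have := Real.add_one_le_exp ((p n : ℝ) * (2 * u))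
        linarith
    _ ≤ Real.exp (Real.log n / 4) := by
        rw [← Real.exp_nat_mul]
        exact Real.exp_le_exp.2 (by linarith)

end Haplotype

theorem corollary2 :
    -- (1) generalized ring graphs
    (∀ pmin : ℝ, 0 < pmin → ∃ c₁ : ℝ, 0 < c₁ ∧
      ∀ (θ₀ pmax : ℝ) (w : ℕ), 0 < θ₀ → 1 ≤ w → ∃ c₂ : ℝ, 0 < c₂ ∧ c₂ < c₁ ∧
        ∀ (θ L : ℕ → ℝ) (p : ℕ → ℕ → ℝ) (m : ℕ → ℕ → ℕ),
          (∀ n, θ₀ ≤ θ n ∧ θ n < 1 / 2) →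
          (∀ n, 0 < L n) →
          (∀ n l, 1 ≤ l → l ≤ w →
            pmin ≤ p n l ∧ p n l ≤ pmax ∧ (m n l : ℝ) = L n * p n l) →
          ((∀ᶠ n : ℕ in atTop, c₁ * (Real.log n / L n) < (1 - 2 * θ n) ^ 2) →
            Tendsto (fun n => Haplotype.ringMinimaxError n w (m n) (θ n)) atTop (𝓝 0)) ∧
          ((∃ᶠ n : ℕ in atTop, (1 - 2 * θ n) ^ 2 < c₂ * (Real.log n / L n)) →
            ¬ Tendsto (fun n => Haplotype.ringMinimaxError n w (m n) (θ n)) atTop (𝓝 0))) ∧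
    -- (2) Erdős–Rényi graphs
    (∃ c₃ : ℝ, 0 < c₃ ∧ ∃ c₄ : ℝ, 0 < c₄ ∧
      ∀ θ₀ : ℝ, 0 < θ₀ → ∃ c₅ : ℝ, 0 < c₅ ∧
        ∀ (θ : ℕ → ℝ) (L : ℕ → ℕ) (pobs : ℕ → I),
          (∀ n, θ₀ ≤ θ n ∧ θ n < 1 / 2) →
          (∀ n, 1 ≤ L n) →
          (∀ᶠ n : ℕ in atTop, c₃ * Real.log n / n < (pobs n : ℝ)) →
          ((∀ᶠ n : ℕ in atTop,
              c₄ * Real.log n / (L n * n * (pobs n : ℝ)) < (1 - 2 * θ n) ^ 2) →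
            Tendsto (fun n => Haplotype.erMinimaxError n (pobs n) (L n) (θ n)) atTop (𝓝 0)) ∧
          ((∃ᶠ n : ℕ in atTop,
              (1 - 2 * θ n) ^ 2 < c₅ * Real.log n / (L n * n * (pobs n : ℝ))) →
            ¬ Tendsto (fun n => Haplotype.erMinimaxError n (pobs n) (L n) (θ n))
              atTop (𝓝 0))) := by
  refine ⟨fun pmin hpmin => ⟨4 / pmin, by positivity, fun θ₀ pmax w hθ₀ hw => ?_⟩,
    12, by norm_num, 12, by norm_num, fun θ₀ hθ₀ => ⟨θ₀ / 16, by positivity,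
      fun θ L p hθ hL hp => ⟨fun h => ?_, fun h => ?_⟩⟩⟩
  -- No sign is assumed for `pmax`, so it is replaced by a positive upper bound.
  · set q := max pmax 1
    have hq : 0 < q := lt_of_lt_of_le one_pos (le_max_right _ _)
    -- The entry `2 / pmin` serves only to keep `c₂` strictly below `c₁ = 4 / pmin`.
    refine ⟨min (2 / pmin) (θ₀ / (8 * (2 * w + 1) * q)), lt_min (by positivity) (by positivity),
      (min_le_left _ _).trans_lt (by gcongr; norm_num), fun θ L p m hθ hL hm =>
        ⟨fun h => ?_, fun h => ?_⟩⟩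
    · refine Haplotype.tendsto_ringMinimaxError hpmin hw (fun n => hθ₀.trans_le (hθ n).1)
        (fun n => by linarith [(hθ n).2]) hL (fun n => ?_) h
      obtain ⟨h1, -, h3⟩ := hm n 1 le_rfl hw
      rw [h3]
      exact mul_le_mul_of_nonneg_left h1 (hL n).le
    · refine Haplotype.not_tendsto_ringMinimaxError hθ₀ hq hθ hL (fun n l hl hlw => ?_)
        (min_le_right _ _) h
      obtain ⟨-, h2, h3⟩ := hm n l hl hlw
      rw [h3]
      exact mul_le_mul_of_nonneg_left (h2.trans (le_max_left _ _)) (hL n).le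
  · exact Haplotype.tendsto_erMinimaxError (fun n => hθ₀.trans_le (hθ n).1)
      (fun n => by linarith [(hθ n).2]) hL hp h
  · exact Haplotype.not_tendsto_erMinimaxError hθ₀ hθ hL hp h
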